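/- All graphs are finite and simple. For graphs $F$ and $G$, where $F$ has at least one edge, let $ex_F(n,G)$ (the $F$-multicolor Tur\'an number of $G$) be the maximum number of pairwise edge-disjoint copies of $F$ on an $n$-element vertex set such that there is no copy of $G$ whose edges come from pairwise distinct copies of $F$. Write $f(n)=n^{2-o(1)}$ if $f(n)=n^{2-\varepsilon(n)}$ for all large $n$ with some $\varepsilon(n)\to 0$. Let $F(s)$ be the $s$-blow-up of $F$ (each vertex is replaced by an independent set of size $s$ and each edge by a complete bipartite graph), let $\mathrm{Epi}(G)$ be the set of graphs $G'$ for which there is a homomorphism $G\to G'$ that is surjective on vertices and on edges, and let the odd girth of a graph be the length of its shortest odd cycle. (1) Let $F$ have at least one edge. Suppose that $ex_F(n,G)=n^{2-o(1)}$ and that no graph in $\mathrm{Epi}(G)$ with fewer vertices than $G$ is isomorphic to a (not necessarily induced) subgraph of $F$. Then $ex_{F(s)}(n,G)=n^{2-o(1)}$ for every integer $s\ge 1$; if moreover $ex_F(n,G)=o(n^2)$, then also $ex_{F(s)}(n,G)=o(n^2)$. (2) Suppose that $F$ and $G$ have the same odd girth $k$, that $\chi(F)=3$, and that there is a homomorphism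 from $G$ to $F$. Then $ex_{C_k}(n,G)=n^{2-o(1)}$ and $ex_F(n,G)=o(n^2)$; if moreover there is a homomorphism from $F$ to $C_k$, then $ex_F(n,G)=n^{2-o(1)}$. In particular, for every odd $k\ge 3$, $ex_{C_k}(n,C_k)=n^{2-o(1)}$ and $ex_{C_k}(n,C_k)=o(n^2)$. -/

import Mathlib

open Filter Topology Asymptotics

namespace MulticolorTuran

/-- The set of edges of `H` covered by a copy `c` of `F` in `H`. -/
def copyEdges {V U : Type*} {F : SimpleGraph V} {H : SimpleGraph U} (c : F.Copy H) :
    Set (Sym2 U) :=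
  Sym2.map c '' F.edgeSet

/-- The copies `c i` of `F` on the vertex set `Fin n` are pairwise edge-disjoint.
The copy `c i` is regarded as monochromatic of colour `i`. -/
def EdgeDisjointCopies {V : Type*} {F : SimpleGraph V} {n m : ℕ}
    (c : Fin m → F.Copy (⊤ : SimpleGraph (Fin n))) : Prop :=
  Pairwise fun i j => Disjoint (copyEdges (c i)) (copyEdges (c j))

/-- There is a rainbow copy of `G`: a copy `g` of `G` on `Fin n` each of whose edges is covered by
one of the copies `c i`, different edges being covered by different copies. -/
def HasRainbowCopy {V W : Type*} {F : SimpleGraph V} (G : SimpleGraph W) {n m : ℕ}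
    (c : Fin m → F.Copy (⊤ : SimpleGraph (Fin n))) : Prop :=
  ∃ (g : G.Copy (⊤ : SimpleGraph (Fin n))) (col : G.edgeSet → Fin m),
    Function.Injective col ∧ ∀ e : G.edgeSet, Sym2.map g (e : Sym2 W) ∈ copyEdges (c (col e))

/-- The `F`-multicolor Turán number `ex_F(n, G)`: the maximum number of edge-disjoint copies of `F`
on `n` vertices without a copy of `G` whose edges come from distinct copies of `F`.
(It is a maximum of a bounded set as soon as `F` has an edge.) -/
noncomputable def exMulti {V W : Type*} (F : SimpleGraph V) (n : ℕ) (G : SimpleGraph W) : ℕ :=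
  sSup {m : ℕ | ∃ c : Fin m → F.Copy (⊤ : SimpleGraph (Fin n)),
    EdgeDisjointCopies c ∧ ¬ HasRainbowCopy G c}

/-- `f(n) = n^{2 - o(1)}` as `n → ∞`. -/
def IsTwoSubLittleOOne (f : ℕ → ℕ) : Prop :=
  ∃ ε : ℕ → ℝ, Tendsto ε atTop (𝓝 0) ∧ ∀ᶠ n : ℕ in atTop, (f n : ℝ) = (n : ℝ) ^ (2 - ε n)

/-- `f(n) = o(n ^ 2)` as `n → ∞`. -/
def IsSubquadratic (f : ℕ → ℕ) : Prop :=
  (fun n : ℕ => (f n : ℝ)) =o[atTop] fun n : ℕ => (n : ℝ) ^ 2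

/-- The `s`-blow-up `F(s)`: every vertex is replaced by an independent set of size `s`, and every
edge by a complete bipartite graph. -/
def blowUp {V : Type*} (F : SimpleGraph V) (s : ℕ) : SimpleGraph (V × Fin s) :=
  F.comap Prod.fst

/-- `G' ∈ Epi(G)`: there is a homomorphism from `G` to `G'` which is surjective on vertices and
on edges. -/
def IsEpimorphicImage {W X : Type*} (G : SimpleGraph W) (G' : SimpleGraph X) : Prop :=
  ∃ φ : G →g G', Function.Surjective φ ∧
    ∀ x y, G'.Adj x y → ∃ a b, G.Adj a b ∧ φ a = x ∧ φ b = y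

/-- `k` is the odd girth of `G`: `G` has an odd cycle, and a shortest one has length `k`. -/
def IsOddGirth {V : Type*} (G : SimpleGraph V) (k : ℕ) : Prop :=
  IsLeast {l : ℕ | Odd l ∧ ∃ (v : V) (p : G.Walk v v), p.IsCycle ∧ p.length = l} k

end MulticolorTuran

/-! Blow-ups. In a family of edge-disjoint copies of `F`, a random colouring of the ground set by
the vertices of `F` fits a copy (every vertex gets the colour of its own role) with probability `|V|
^ (-|V|)`, so some colouring fits a constant proportion of the copies. Keep these and blow each one
up. A rainbow `G` among the blown-up copies projects to the old ground set, and the colouring turns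
the projection into a homomorphism `G → F`. Its image is a smaller epimorphic image of `G` inside
`F` unless it is injective; hence the projection is injective and is a rainbow `G` in the old
family. This is `exMulti_le_mul_exMulti_blowUp`.

Lower bound for odd cycles. Behrend's idea: in `k` layers of a grid take the cycles with `i`-th
vertex `x + i a`, where `a` runs over a sphere. A rainbow `C_k` projects to an endomorphism of
`C_k`, which is a rotation or reflection because `k` is odd. So it meets each layer once, and its
closing edge says that the direction of one cycle is the average of the `k - 1` others. Strict
convexity of the sphere makes all directions equal, so two of its edges lie in the same cycle. If
`C_k ⊆ G` and `F → C_k`, then `F` lies in a blow-up of `C_k`, and monotonicity together with the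
blow-up result bounds `ex_F(n, G)` from below.

Upper bound from a homomorphism `G → F`. By Szemerédi regularity, some copy of `F` among
quadratically many edge-disjoint ones keeps all its edges after cleaning. Its parts then support `κ
n ^ |W|` homomorphic images of `G`, of which only `O(n ^ (|W| - 1))` are degenerate or not rainbow.
-/

namespace MulticolorTuran

/-! ### Bounds and monotonicity for the multicolor Turán number -/

section Basic

variable {V V' W W' : Type*} {F : SimpleGraph V} {F' : SimpleGraph V'} {G : SimpleGraph W}
  {G' : SimpleGraph W'}

theorem mem_copyEdges_mk {U : Type*} {H : SimpleGraph U} {c : F.Copy H} {x y : U} :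
    s(x, y) ∈ copyEdges c ↔ ∃ a b, F.Adj a b ∧ c a = x ∧ c b = y := by
  constructor
  · rintro ⟨e, he, hxy⟩
    induction e with | _ a b =>
    rw [SimpleGraph.mem_edgeSet] at he
    rw [Sym2.map_mk, Sym2.eq_iff] at hxy
    rcases hxy with ⟨h1, h2⟩ | ⟨h1, h2⟩
    · exact ⟨a, b, he, h1, h2⟩
    · exact ⟨b, a, he.symm, h2, h1⟩
  · rintro ⟨a, b, hab, rfl, rfl⟩
    exact ⟨s(a, b), hab, rfl⟩

theorem exists_adj_of_ne_bot (hF : F ≠ ⊥) : ∃ a b, F.Adj a b := by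
  by_contra! h
  exact hF (by ext a b; simpa using h a b)

theorem card_le_sq_of_edgeDisjoint (hF : F ≠ ⊥) {n m : ℕ}
    {c : Fin m → F.Copy (⊤ : SimpleGraph (Fin n))} (hc : EdgeDisjointCopies c) : m ≤ n ^ 2 := by
  obtain ⟨a, b, hab⟩ := exists_adj_of_ne_bot hF
  have hinj : Function.Injective fun i => (c i a, c i b) := by
    intro i j hij
    by_contra hne
    simp only [Prod.mk.injEq] at hij
    refine Set.disjoint_left.1 (hc hne) (mem_copyEdges_mk.2 ⟨a, b, hab, rfl, rfl⟩) ?_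
    exact mem_copyEdges_mk.2 ⟨a, b, hab, hij.1.symm, hij.2.symm⟩
  simpa [sq] using Fintype.card_le_of_injective _ hinj

theorem exMulti_le {n B : ℕ} (h : ∀ m (c : Fin m → F.Copy (⊤ : SimpleGraph (Fin n))),
    EdgeDisjointCopies c → ¬ HasRainbowCopy G c → m ≤ B) : exMulti F n G ≤ B := by
  refine csSup_le' ?_
  rintro m ⟨c, hc, hG⟩
  exact h m c hc hG

theorem exMulti_le_sq (hF : F ≠ ⊥) (n : ℕ) : exMulti F n G ≤ n ^ 2 :=
  exMulti_le fun _ _ hc _ => card_le_sq_of_edgeDisjoint hF hc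

theorem le_exMulti (hF : F ≠ ⊥) {n m : ℕ} (c : Fin m → F.Copy (⊤ : SimpleGraph (Fin n)))
    (hc : EdgeDisjointCopies c) (hG : ¬ HasRainbowCopy G c) : m ≤ exMulti F n G := by
  refine le_csSup ⟨n ^ 2, ?_⟩ ⟨c, hc, hG⟩
  rintro m' ⟨c', hc', -⟩
  exact card_le_sq_of_edgeDisjoint hF hc'

/-- A family of copies on an arbitrary vertex set without rainbow homomorphic images of `G` bounds
the multicolor Turán number from below. -/
theorem card_le_exMulti (hF : F ≠ ⊥) {ι U : Type*} [Fintype ι] [Fintype U] [Nonempty U] {n : ℕ}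
    (c : ι → F.Copy (⊤ : SimpleGraph U))
    (hc : Pairwise fun i j => Disjoint (copyEdges (c i)) (copyEdges (c j)))
    (hn : Fintype.card U ≤ n)
    (hG : ∀ (g : W → U) (col : G.edgeSet → ι), Function.Injective col →
      ¬ ∀ e : G.edgeSet, Sym2.map g (e : Sym2 W) ∈ copyEdges (c (col e))) :
    Fintype.card ι ≤ exMulti F n G := by
  obtain ⟨φ⟩ : Nonempty (U ↪ Fin n) := Function.Embedding.nonempty_of_card_le (by simpa using hn)
  let e := Fintype.equivFin ι
  let c' : Fin (Fintype.card ι) → F.Copy (⊤ : SimpleGraph (Fin n)) := fun i =>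
    ((SimpleGraph.Embedding.completeGraph φ).toCopy).comp (c (e.symm i))
  have hc' : ∀ i, copyEdges (c' i) = Sym2.map φ '' copyEdges (c (e.symm i)) := by
    intro i
    simp only [copyEdges, Set.image_image, Sym2.map_map]
    rfl
  refine le_exMulti hF c' ?_ ?_
  · intro i j hij
    rw [hc', hc']
    exact Set.disjoint_image_of_injective (Sym2.map.injective φ.injective)
      (hc (e.symm.injective.ne hij))
  · rintro ⟨g, col, hcol, hg⟩
    -- Only isolated vertices of `G` can lie outside the range of `φ`; `invFun` may merge them with
    -- others, which is why `hG` concerns arbitrary maps `g`.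
    refine hG (Function.invFun φ ∘ g) (e.symm ∘ col) (e.symm.injective.comp hcol) fun x => ?_
    have := hg x
    rw [hc'] at this
    obtain ⟨y, hy, hxy⟩ := this
    rw [← Sym2.map_map, ← hxy, Sym2.map_map, (Function.leftInverse_invFun φ.injective).comp_eq_id,
      Sym2.map_id]
    exact hy

theorem exMulti_mono_left (hF : F ≠ ⊥) (f : F.Copy F') (n : ℕ) :
    exMulti F' n G ≤ exMulti F n G := by
  refine exMulti_le fun m c hc hG => ?_
  have hsub : ∀ i, copyEdges ((c i).comp f) ⊆ copyEdges (c i) := by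
    rintro i _ ⟨e, he, rfl⟩
    refine ⟨Sym2.map f e, ?_, by rw [Sym2.map_map]; rfl⟩
    induction e with | _ a b => exact f.toHom.map_adj he
  refine le_exMulti hF (fun i => (c i).comp f) (fun i j hij => (hc hij).mono (hsub i) (hsub j)) ?_
  rintro ⟨g, col, hcol, hg⟩
  exact hG ⟨g, col, hcol, fun e => hsub _ (hg e)⟩

theorem HasRainbowCopy.mono (f : G'.Copy G) {n m : ℕ}
    {c : Fin m → F.Copy (⊤ : SimpleGraph (Fin n))} (h : HasRainbowCopy G c) :
    HasRainbowCopy G' c := by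
  obtain ⟨g, col, hcol, hg⟩ := h
  refine ⟨((SimpleGraph.Embedding.completeGraph g.toEmbedding).toCopy).comp
    (⟨⟨f, fun h => by simpa using f.injective.ne h.ne⟩, f.injective⟩ :
      G'.Copy (⊤ : SimpleGraph W)), col ∘ f.mapEdgeSet, hcol.comp f.mapEdgeSet.injective, ?_⟩
  intro e
  have := hg (f.mapEdgeSet e)
  rw [show ((f.mapEdgeSet e : G.edgeSet) : Sym2 W) = Sym2.map f e from rfl, Sym2.map_map] at this
  exact this

theorem exMulti_mono_right (hF : F ≠ ⊥) (f : G'.Copy G) (n : ℕ) :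
    exMulti F n G' ≤ exMulti F n G :=
  exMulti_le fun _ c hc hG => le_exMulti hF c hc fun h => hG (h.mono f)

end Basic

/-! ### Growth rates `n^{2-o(1)}` and `o(n^2)` -/

section Asymptotic

theorem isTwoSubLittleOOne_of_le {f : ℕ → ℕ} (hub : ∀ n, f n ≤ n ^ 2)
    (hlb : ∀ δ : ℝ, 0 < δ → ∀ᶠ n : ℕ in atTop, (n : ℝ) ^ (2 - δ) ≤ f n) :
    IsTwoSubLittleOOne f := by
  have hpos : ∀ᶠ n : ℕ in atTop, 2 ≤ n ∧ 0 < (f n : ℝ) := by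
    filter_upwards [hlb 1 one_pos, eventually_ge_atTop 2] with n hn h2
    refine ⟨h2, lt_of_lt_of_le ?_ hn⟩
    have : (0 : ℝ) < n := by positivity
    positivity
  refine ⟨fun n => 2 - Real.log (f n) / Real.log n, ?_, ?_⟩
  · rw [Metric.tendsto_nhds]
    intro δ hδ
    filter_upwards [hlb (δ / 2) (by positivity), hpos] with n hn ⟨h2, hf⟩
    have hn1 : (1 : ℝ) < n := by exact_mod_cast h2
    have hlog : 0 < Real.log n := Real.log_pos hn1
    have h1 : (2 - δ / 2) * Real.log n ≤ Real.log (f n) := by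
      rw [← Real.log_rpow (by linarith)]
      exact Real.log_le_log (by positivity) hn
    have h3 : Real.log (f n) ≤ 2 * Real.log n := by
      rw [show (2 : ℝ) * Real.log n = Real.log ((n : ℝ) ^ 2) by simp]
      exact Real.log_le_log hf (by exact_mod_cast hub n)
    have h4 : 2 - δ / 2 ≤ Real.log (f n) / Real.log n := (le_div_iff₀ hlog).2 h1
    have h5 : Real.log (f n) / Real.log n ≤ 2 := (div_le_iff₀ hlog).2 h3
    rw [Real.dist_eq, sub_zero, abs_lt]
    constructor <;> linarith
  · filter_upwards [hpos] with n ⟨h2, hf⟩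
    have hn1 : (1 : ℝ) < n := by exact_mod_cast h2
    have hlog : 0 < Real.log n := Real.log_pos hn1
    rw [sub_sub_cancel, Real.rpow_def_of_pos (by linarith), mul_div_cancel₀ _ hlog.ne',
      Real.exp_log hf]

theorem IsTwoSubLittleOOne.eventually_le {f : ℕ → ℕ} (hf : IsTwoSubLittleOOne f) {δ : ℝ}
    (hδ : 0 < δ) : ∀ᶠ n : ℕ in atTop, (n : ℝ) ^ (2 - δ) ≤ f n := by
  obtain ⟨ε, hε, h⟩ := hf
  filter_upwards [h, hε.eventually (gt_mem_nhds hδ), eventually_ge_atTop 1] with n hn hlt h1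
  rw [hn]
  exact Real.rpow_le_rpow_of_exponent_le (by exact_mod_cast h1) (by linarith)

theorem eventually_rpow_le_mul_rpow {a b C : ℝ} (hab : a < b) (hC : 0 < C) :
    ∀ᶠ n : ℕ in atTop, (n : ℝ) ^ a ≤ C * (n : ℝ) ^ b := by
  have := ((tendsto_rpow_atTop (sub_pos.2 hab)).comp tendsto_natCast_atTop_atTop).eventually_ge_atTop
    (1 / C)
  filter_upwards [this, eventually_ge_atTop 1] with n hn h1
  have hn0 : (0 : ℝ) < n := by exact_mod_cast h1
  simp only [Function.comp_apply] at hn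
  rw [show b = (b - a) + a by ring, Real.rpow_add hn0]
  rw [div_le_iff₀ hC] at hn
  have := Real.rpow_nonneg hn0.le a
  nlinarith

/-- Passing from `n` to `n / s ≥ n / (2s)` and dividing by `K` cost only a constant factor, which
the gap between `n ^ (2 - δ / 2)` and `n ^ (2 - δ)` absorbs. -/
theorem IsTwoSubLittleOOne.of_le_mul {f g : ℕ → ℕ} {s K : ℕ} (hs : 1 ≤ s) (hK : 0 < K)
    (hf : IsTwoSubLittleOOne f) (hub : ∀ n, g n ≤ n ^ 2) (h : ∀ n, f (n / s) ≤ K * g n) :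
    IsTwoSubLittleOOne g := by
  refine isTwoSubLittleOOne_of_le hub fun δ hδ => ?_
  wlog hδ1 : δ ≤ 1 generalizing δ
  · filter_upwards [this 1 one_pos le_rfl, eventually_ge_atTop 1] with n hn h1
    exact (Real.rpow_le_rpow_of_exponent_le (by exact_mod_cast h1) (by linarith)).trans hn
  have hs0 : (0 : ℝ) < s := by exact_mod_cast hs
  have hK0 : (0 : ℝ) < K := by exact_mod_cast hK
  have h1 := (Nat.tendsto_div_const_atTop (by omega : s ≠ 0)).eventually
    (hf.eventually_le (half_pos hδ))
  have h2 := eventually_rpow_le_mul_rpow (a := 2 - δ) (b := 2 - δ / 2)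
    (C := (1 / (2 * s : ℝ)) ^ (2 - δ / 2) / K) (by linarith) (by positivity)
  filter_upwards [h1, h2, eventually_ge_atTop s] with n h1 h2 hn
  have hle : (1 / (2 * s : ℝ)) * n ≤ (n / s : ℕ) := by
    have hq : n < 2 * s * (n / s) := by
      have h3 := Nat.div_add_mod n s
      have h4 := Nat.mod_lt n (by omega : s > 0)
      have h5 : 1 ≤ n / s := (Nat.one_le_div_iff (by omega)).2 hn
      have h6 : s * 1 ≤ s * (n / s) := Nat.mul_le_mul_left s h5
      have h7 : 2 * s * (n / s) = s * (n / s) + s * (n / s) := by ring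
      omega
    rw [one_div, inv_mul_le_iff₀ (by positivity)]
    exact_mod_cast hq.le
  have h3 : ((1 / (2 * s : ℝ)) * n) ^ (2 - δ / 2) ≤ ((n / s : ℕ) : ℝ) ^ (2 - δ / 2) :=
    Real.rpow_le_rpow (by positivity) hle (by linarith)
  rw [Real.mul_rpow (by positivity) (by positivity)] at h3
  have h4 : ((f (n / s) : ℕ) : ℝ) ≤ K * g n := by exact_mod_cast h n
  calc (n : ℝ) ^ (2 - δ) ≤ _ := h2
    _ = ((1 / (2 * s : ℝ)) ^ (2 - δ / 2) * (n : ℝ) ^ (2 - δ / 2)) / K := by ring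
    _ ≤ (K * g n) / K := div_le_div_of_nonneg_right (h3.trans (h1.trans h4)) hK0.le
    _ = g n := by field_simp

theorem IsSubquadratic.mono {f g : ℕ → ℕ} (hf : IsSubquadratic f) (h : ∀ n, g n ≤ f n) :
    IsSubquadratic g := by
  refine IsBigO.trans_isLittleO (IsBigO.of_bound 1 (Eventually.of_forall fun n => ?_)) hf
  simpa using h n

theorem IsTwoSubLittleOOne.mono {f g : ℕ → ℕ} (hf : IsTwoSubLittleOOne f)
    (hub : ∀ n, g n ≤ n ^ 2) (h : ∀ n, f n ≤ g n) : IsTwoSubLittleOOne g :=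
  hf.of_le_mul le_rfl one_pos hub (by simpa using h)

end Asymptotic

/-! ### Partite subfamilies and blow-ups -/

section BlowUp

variable {V W : Type*} {F : SimpleGraph V} {G : SimpleGraph W}

/-- The image of a non-injective homomorphism, with exactly the edges hit by `G`, would be a
forbidden smaller epimorphic image contained in `F`. -/
theorem injective_of_forall_isEpimorphicImage [Fintype W]
    (h : ∀ m : ℕ, m < Fintype.card W → ∀ G' : SimpleGraph (Fin m),
      IsEpimorphicImage G G' → ¬ G'.IsContained F) (θ : G →g F) : Function.Injective θ := by
  classical
  by_contra hθ
  let e := Fintype.equivFin (Set.range θ)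
  have hlt : Fintype.card (Set.range θ) < Fintype.card W := by
    refine lt_of_le_of_ne (Fintype.card_range_le θ) fun heq => hθ ?_
    have hb := (Fintype.bijective_iff_surjective_and_card (Set.rangeFactorization θ)).2
      ⟨Set.rangeFactorization_surjective, heq.symm⟩
    exact fun a b hab => hb.1 (Subtype.ext hab)
  let p : W → Fin (Fintype.card (Set.range θ)) := fun w => e (Set.rangeFactorization θ w)
  have hp : ∀ w, ((e.symm (p w) : Set.range θ) : V) = θ w := fun w => by
    simp [p, Set.rangeFactorization]
  let G' : SimpleGraph (Fin (Fintype.card (Set.range θ))) :=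
    { Adj := fun x y => ∃ a b, G.Adj a b ∧ p a = x ∧ p b = y
      symm := ⟨fun x y ⟨a, b, hab, ha, hb⟩ => ⟨b, a, hab.symm, hb, ha⟩⟩
      loopless := ⟨fun x ⟨a, b, hab, ha, hb⟩ => by
        have := θ.map_adj hab
        rw [← hp a, ← hp b, ha, hb] at this
        exact this.ne rfl⟩ }
  refine h _ hlt G' ⟨⟨p, fun {a b} hab => ⟨a, b, hab, rfl, rfl⟩⟩, ?_, fun x y hxy => hxy⟩ ?_
  · exact e.surjective.comp Set.rangeFactorization_surjective
  · refine ⟨⟨⟨fun x => (e.symm x : V), ?_⟩, ?_⟩⟩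
    · rintro _ _ ⟨a, b, hab, rfl, rfl⟩
      rw [hp, hp]
      exact θ.map_adj hab
    · exact Subtype.val_injective.comp e.symm.injective

/-- Some colouring of `U` by `V` restricts to the identity on a constant proportion of a given
family of injections of `V` into `U`. -/
theorem exists_partite_subfamily [Fintype V] [Nonempty V] {U ι : Type*} [Fintype U] [Fintype ι]
    (c : ι → V → U) (hc : ∀ i, Function.Injective (c i)) :
    ∃ χ : U → V, Fintype.card ι ≤
      Fintype.card V ^ Fintype.card V * Nat.card {i // ∀ v, χ (c i v) = v} := by
  classical
  have key : ∀ i, Fintype.card V ^ Fintype.card U ≤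
      Fintype.card V ^ Fintype.card V *
        (Finset.univ.filter fun χ : U → V => ∀ v, χ (c i v) = v).card := by
    intro i
    -- A colouring is recovered from its values on the copy and from its modification that fits the
    -- copy, so at least one in `|V| ^ |V|` colourings fits.
    let f : (U → V) → (V → V) × {χ : U → V // ∀ v, χ (c i v) = v} := fun χ =>
      (χ ∘ c i, ⟨fun u => if h : ∃ v, c i v = u then h.choose else χ u, fun v => by
        have h : ∃ v', c i v' = c i v := ⟨v, rfl⟩
        exact (dif_pos h).trans (hc i h.choose_spec)⟩)
    have hf : Function.Injective f := by
      intro χ χ' hχ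
      simp only [f, Prod.mk.injEq, Subtype.mk.injEq] at hχ
      funext u
      by_cases h : ∃ v, c i v = u
      · obtain ⟨v, rfl⟩ := h
        exact congrFun hχ.1 v
      · simpa [h] using congrFun hχ.2 u
    have := Fintype.card_le_of_injective f hf
    rw [Fintype.card_prod, Fintype.card_subtype] at this
    simpa using this
  obtain ⟨χ, -, hχ⟩ : ∃ χ ∈ (Finset.univ : Finset (U → V)), Fintype.card ι ≤
      Fintype.card V ^ Fintype.card V *
        (Finset.univ.filter fun i => ∀ v, χ (c i v) = v).card := by
    refine Finset.exists_le_of_sum_le Finset.univ_nonempty ?_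
    rw [← Finset.mul_sum]
    have hswap : ∑ χ : U → V, (Finset.univ.filter fun i => ∀ v, χ (c i v) = v).card =
        ∑ i, (Finset.univ.filter fun χ : U → V => ∀ v, χ (c i v) = v).card := by
      simp only [Finset.card_filter]
      exact Finset.sum_comm
    rw [hswap, Finset.mul_sum]
    calc _ = ∑ _i : ι, Fintype.card V ^ Fintype.card U := by simp [mul_comm]
      _ ≤ _ := Finset.sum_le_sum fun i _ => key i
  refine ⟨χ, ?_⟩
  rwa [Nat.card_eq_fintype_card, Fintype.card_subtype]

/-- The blow-up of a copy of `F`. -/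
def blowUpCopy {U : Type*} (s : ℕ) (c : F.Copy (⊤ : SimpleGraph U)) :
    (blowUp F s).Copy (⊤ : SimpleGraph (U × Fin s)) :=
  ⟨⟨fun x => (c x.1, x.2), fun {x y} (h : F.Adj x.1 y.1) hxy =>
    h.ne (c.injective (congrArg Prod.fst hxy))⟩, fun x y hxy => by
    have h := Prod.mk.inj hxy
    exact Prod.ext (c.injective h.1) h.2⟩

theorem mem_copyEdges_blowUpCopy {U : Type*} {s : ℕ} {c : F.Copy (⊤ : SimpleGraph U)}
    {x y : U × Fin s} (h : s(x, y) ∈ copyEdges (blowUpCopy s c)) :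
    ∃ a b, F.Adj a b ∧ c a = x.1 ∧ c b = y.1 := by
  obtain ⟨a, b, hab, rfl, rfl⟩ := mem_copyEdges_mk.1 h
  exact ⟨a.1, b.1, hab, rfl, rfl⟩

theorem blowUp_ne_bot (hF : F ≠ ⊥) {s : ℕ} (hs : 1 ≤ s) : blowUp F s ≠ ⊥ := by
  obtain ⟨a, b, hab⟩ := exists_adj_of_ne_bot hF
  intro h
  have : (blowUp F s).Adj (a, ⟨0, hs⟩) (b, ⟨0, hs⟩) := hab
  rw [h] at this
  exact this

theorem exMulti_le_mul_exMulti_blowUp [Fintype V] (hF : F ≠ ⊥)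
    (hinj : ∀ θ : G →g F, Function.Injective θ) {s : ℕ} (hs : 1 ≤ s) (n : ℕ) :
    exMulti F (n / s) G ≤
      Fintype.card V ^ Fintype.card V * exMulti (blowUp F s) n G := by
  classical
  refine exMulti_le fun m c hc hG => ?_
  obtain ⟨a₀, b₀, hab₀⟩ := exists_adj_of_ne_bot hF
  have : Nonempty V := ⟨a₀⟩
  rcases Nat.eq_zero_or_pos m with rfl | hm
  · exact Nat.zero_le _
  have : Nonempty (Fin (n / s)) := ⟨c ⟨0, hm⟩ a₀⟩
  have : Nonempty (Fin s) := ⟨⟨0, hs⟩⟩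
  obtain ⟨χ, hχ⟩ := exists_partite_subfamily (fun i v => c i v) fun i => (c i).injective
  rw [Fintype.card_fin] at hχ
  refine hχ.trans (Nat.mul_le_mul_left _ ?_)
  rw [Nat.card_eq_fintype_card]
  refine card_le_exMulti (blowUp_ne_bot hF hs) (U := Fin (n / s) × Fin s)
    (fun i => blowUpCopy s (c i.1)) ?_ ?_ ?_
  · intro i j hij
    rw [Set.disjoint_left]
    intro e hi hj
    induction e with | _ x y =>
    obtain ⟨a, b, hab, ha, hb⟩ := mem_copyEdges_blowUpCopy hi
    obtain ⟨a', b', hab', ha', hb'⟩ := mem_copyEdges_blowUpCopy hj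
    exact Set.disjoint_left.1 (hc fun h => hij (Subtype.ext h))
      (mem_copyEdges_mk.2 ⟨a, b, hab, ha, hb⟩) (mem_copyEdges_mk.2 ⟨a', b', hab', ha', hb'⟩)
  · simpa using Nat.div_mul_le_self n s
  · intro g col hcol hg
    have hedge : ∀ (a b : W) (h : G.Adj a b), ∃ v v', F.Adj v v' ∧
        c (col ⟨s(a, b), h⟩) v = (g a).1 ∧ c (col ⟨s(a, b), h⟩) v' = (g b).1 := fun a b h =>
      mem_copyEdges_blowUpCopy (hg ⟨s(a, b), h⟩)
    -- On a kept copy `χ` inverts the embedding, so it carries covered edges back to edges of `F`.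
    let θ : G →g F := ⟨fun w => χ (g w).1, fun {a b} h => by
      obtain ⟨v, v', hv, ha, hb⟩ := hedge a b h
      have hcol := (col ⟨s(a, b), h⟩).2
      rwa [← ha, ← hb, hcol, hcol]⟩
    have hp : Function.Injective fun w => (g w).1 := fun a b hab => hinj θ (congrArg χ hab)
    refine hG ⟨⟨⟨fun w => (g w).1, fun h => hp.ne h.ne⟩, hp⟩, fun e => (col e).1,
      Subtype.val_injective.comp hcol, ?_⟩
    rintro ⟨e, he⟩
    induction e with | _ a b => exact mem_copyEdges_mk.2 (hedge a b he)

theorem isTwoSubLittleOOne_blowUp [Fintype V] (hF : F ≠ ⊥)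
    (hinj : ∀ θ : G →g F, Function.Injective θ)
    (h : IsTwoSubLittleOOne fun n => exMulti F n G) {s : ℕ} (hs : 1 ≤ s) :
    IsTwoSubLittleOOne fun n => exMulti (blowUp F s) n G := by
  obtain ⟨a, -⟩ := exists_adj_of_ne_bot hF
  have : Nonempty V := ⟨a⟩
  exact h.of_le_mul hs (pow_pos Fintype.card_pos _) (exMulti_le_sq (blowUp_ne_bot hF hs))
    (exMulti_le_mul_exMulti_blowUp hF hinj hs)

/-- The copy of `F` in its blow-up given by one vertex of each class. -/
def copyBlowUp (F : SimpleGraph V) {s : ℕ} (hs : 1 ≤ s) : F.Copy (blowUp F s) :=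
  ⟨⟨fun v => (v, ⟨0, hs⟩), fun h => h⟩, fun _ _ h => congrArg Prod.fst h⟩

/-- A homomorphism to `F` makes its source a subgraph of a blow-up of `F`. -/
noncomputable def copyBlowUpOfHom [Fintype W] (f : G →g F) :
    G.Copy (blowUp F (Fintype.card W)) :=
  ⟨⟨fun w => (f w, Fintype.equivFin W w), fun h => f.map_adj h⟩,
    fun _ _ h => (Fintype.equivFin W).injective (congrArg Prod.snd h)⟩

end BlowUp

/-! ### Endomorphisms of odd cycles -/

section CycleHom

open Fin.CommRing

theorem cycleGraph_adj_iff_add_one {n : ℕ} {u v : Fin (n + 2)} :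
    (SimpleGraph.cycleGraph (n + 2)).Adj u v ↔ v = u + 1 ∨ u = v + 1 := by
  rw [SimpleGraph.cycleGraph_adj, or_comm, sub_eq_iff_eq_add', sub_eq_iff_eq_add']

/-- The increments `±1` around the cycle sum to zero modulo `k`, so `k` divides twice the number of
descents. As `k` is odd it divides that number itself, which is therefore `0` or `k`. -/
theorem forall_add_one_or_forall_sub_one {k : ℕ} [NeZero k] (hk : Odd k) {f : Fin k → Fin k}
    (hf : ∀ i, f (i + 1) = f i + 1 ∨ f i = f (i + 1) + 1) :
    (∀ i, f (i + 1) = f i + 1) ∨ ∀ i, f i = f (i + 1) + 1 := by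
  classical
  set B := Finset.univ.filter fun i => ¬ f (i + 1) = f i + 1 with hB
  have hsum : ∑ i, (f (i + 1) - f i) = 0 := by
    rw [Finset.sum_sub_distrib, sub_eq_zero]
    exact Equiv.sum_comp (Equiv.addRight (1 : Fin k)) f
  have hterm : ∀ i, f (i + 1) - f i = 1 - 2 * (if ¬ f (i + 1) = f i + 1 then 1 else 0) := by
    intro i
    by_cases h : f (i + 1) = f i + 1
    · simp [h]
    · rw [if_pos h, (hf i).resolve_left h]
      ring
  have hB2 : ((2 * B.card : ℕ) : Fin k) = 0 := by
    simp only [hterm, Finset.sum_sub_distrib, ← Finset.mul_sum, Finset.sum_boole] at hsum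
    have h1 : ∑ _i : Fin k, (1 : Fin k) = 0 := by simp
    rw [h1, zero_sub, neg_eq_zero] at hsum
    push_cast
    exact hsum
  have hdvd : k ∣ B.card := by
    have := (Fin.natCast_eq_zero).1 hB2
    exact (Nat.Coprime.dvd_of_dvd_mul_left (Nat.coprime_two_right.2 hk) this)
  have hle : B.card ≤ k := by simpa using Finset.card_le_univ B
  rcases Nat.eq_zero_or_pos B.card with h0 | h0
  · left
    intro i
    by_contra h
    have : i ∈ B := by simp [hB, h]
    simp [Finset.card_eq_zero.1 h0] at this
  · right
    have hBk : B = Finset.univ := by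
      apply Finset.eq_univ_of_card
      rw [Fintype.card_fin]
      exact le_antisymm hle (Nat.le_of_dvd h0 hdvd)
    intro i
    have : i ∈ B := by simp [hBk]
    exact (hf i).resolve_left (Finset.mem_filter.1 this).2

/-- An endomorphism of an odd cycle is a rotation or a reflection. -/
theorem cycleGraph_hom_eq {n : ℕ} (hk : Odd (n + 2))
    (f : SimpleGraph.cycleGraph (n + 2) →g SimpleGraph.cycleGraph (n + 2)) :
    (∀ i, f i = f 0 + i) ∨ ∀ i, f i = f 0 - i := by
  have hf : ∀ i, f (i + 1) = f i + 1 ∨ f i = f (i + 1) + 1 := fun i =>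
    cycleGraph_adj_iff_add_one.1 (f.map_adj (cycleGraph_adj_iff_add_one.2 (Or.inl rfl)))
  refine (forall_add_one_or_forall_sub_one hk hf).imp (fun h i => ?_) fun h i => ?_
  · suffices ∀ m : ℕ, f (m : Fin (n + 2)) = f 0 + (m : Fin (n + 2)) by
      simpa using this i
    intro m
    induction m with
    | zero => simp
    | succ m ih => rw [Nat.cast_succ, h, ih]; ring
  · suffices ∀ m : ℕ, f (m : Fin (n + 2)) = f 0 - (m : Fin (n + 2)) by
      simpa using this i
    intro m
    induction m with
    | zero => simp
    | succ m ih =>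
      have := h (m : Fin (n + 2))
      rw [ih] at this
      rw [Nat.cast_succ, ← sub_sub, this]
      ring

theorem cycleGraph_hom_injective {k : ℕ} (hk3 : 3 ≤ k) (hk : Odd k)
    (f : SimpleGraph.cycleGraph k →g SimpleGraph.cycleGraph k) : Function.Injective f := by
  obtain ⟨n, rfl⟩ : ∃ n, k = n + 2 := ⟨k - 2, by omega⟩
  intro a b hab
  rcases cycleGraph_hom_eq hk f with h | h
  · rw [h a, h b] at hab
    exact add_left_cancel hab
  · rw [h a, h b] at hab
    exact sub_right_injective hab

theorem exists_hom_rightInverse {n : ℕ} (hk : Odd (n + 2))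
    (f : SimpleGraph.cycleGraph (n + 2) →g SimpleGraph.cycleGraph (n + 2)) :
    ∃ σ : SimpleGraph.cycleGraph (n + 2) →g SimpleGraph.cycleGraph (n + 2), ∀ i, f (σ i) = i := by
  rcases cycleGraph_hom_eq hk f with h | h
  · refine ⟨⟨fun i => i - f 0, fun {a b} hab => ?_⟩, fun i => ?_⟩
    · rw [cycleGraph_adj_iff_add_one] at hab ⊢
      rcases hab with rfl | rfl
      · left; ring
      · right; ring
    · change f (i - f 0) = i
      rw [h]
      ring
  · refine ⟨⟨fun i => f 0 - i, fun {a b} hab => ?_⟩, fun i => ?_⟩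
    · rw [cycleGraph_adj_iff_add_one] at hab ⊢
      rcases hab with rfl | rfl
      · right; ring
      · left; ring
    · change f (f 0 - i) = i
      rw [h]
      ring

theorem cycleGraph_adj_succ {k i : ℕ} (hi : i + 1 < k) :
    (SimpleGraph.cycleGraph k).Adj ⟨i, by omega⟩ ⟨i + 1, hi⟩ := by
  rw [SimpleGraph.cycleGraph_adj']
  right
  rw [Fin.sub_val_of_le (by simp [Fin.le_def])]
  simp

theorem cycleGraph_ne_bot {k : ℕ} (hk : 3 ≤ k) : SimpleGraph.cycleGraph k ≠ ⊥ := by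
  intro h
  have := cycleGraph_adj_succ (k := k) (i := 0) (by omega)
  rw [h] at this
  exact this

theorem cycleGraph_adj_last {k : ℕ} (hk : 2 ≤ k) :
    (SimpleGraph.cycleGraph k).Adj ⟨k - 1, by omega⟩ ⟨0, by omega⟩ := by
  obtain ⟨n, rfl⟩ : ∃ n, k = n + 2 := ⟨k - 2, by omega⟩
  rw [cycleGraph_adj_iff_add_one]
  left
  ext
  rw [Fin.val_add]
  simp

end CycleHom

/-! ### Behrend-type construction for odd cycles -/

section Behrend

/-- A point of a sphere is an average of points of that sphere only if they all coincide. -/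
theorem eq_of_sum_eq_mul_of_sum_sq_eq {D t : ℕ} {A : ℕ → Fin D → ℤ} {B : Fin D → ℤ} {r : ℤ}
    (hA : ∀ m < t, ∑ j, A m j ^ 2 = r) (hB : ∑ j, B j ^ 2 = r)
    (h : ∀ j, ∑ m ∈ Finset.range t, A m j = t * B j) : ∀ m < t, A m = B := by
  -- Each squared distance is `2r - 2⟨B, A m⟩`, and the inner products sum to `t * r` by the
  -- averaging hypothesis.
  have hzero : ∑ m ∈ Finset.range t, ∑ j, (A m j - B j) ^ 2 = 0 := by
    have h1 : ∀ m ∈ Finset.range t, ∑ j, (A m j - B j) ^ 2 = 2 * r - 2 * ∑ j, B j * A m j := by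
      intro m hm
      rw [Finset.mul_sum, two_mul r]
      nth_rewrite 1 [← hA m (Finset.mem_range.1 hm)]
      rw [← hB, ← Finset.sum_add_distrib, ← Finset.sum_sub_distrib]
      exact Finset.sum_congr rfl fun j _ => by ring
    rw [Finset.sum_congr rfl h1, Finset.sum_sub_distrib,
      ← Finset.mul_sum (f := fun m => ∑ j, B j * A m j), Finset.sum_comm]
    simp_rw [← Finset.mul_sum, h]
    have h2 : ∑ j, B j * ((t : ℤ) * B j) = t * r := by
      rw [← hB, Finset.mul_sum]
      exact Finset.sum_congr rfl fun j _ => by ring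
    rw [h2]
    simp
  intro m hm
  have h1 := (Finset.sum_eq_zero_iff_of_nonneg
    fun m _ => Finset.sum_nonneg fun j _ => sq_nonneg (A m j - B j)).1 hzero m
      (Finset.mem_range.2 hm)
  funext j
  have h2 := (Finset.sum_eq_zero_iff_of_nonneg fun j _ => sq_nonneg (A m j - B j)).1 h1 j
    (Finset.mem_univ j)
  exact sub_eq_zero.1 (pow_eq_zero_iff (two_ne_zero)|>.1 h2)

/-- Pigeonhole over the at most `D * d ^ 2 + 1` possible values of the squared norm. -/
theorem exists_large_sphere (D d : ℕ) : ∃ r : ℕ, d ^ D ≤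
    (D * d ^ 2 + 1) * Fintype.card {a : Fin D → Fin d // ∑ j, (a j : ℕ) ^ 2 = r} := by
  by_contra! h
  have hmaps : ∀ a ∈ (Finset.univ : Finset (Fin D → Fin d)),
      ∑ j, (a j : ℕ) ^ 2 ∈ Finset.range (D * d ^ 2 + 1) := by
    intro a _
    rw [Finset.mem_range, Nat.lt_succ_iff]
    calc ∑ j, (a j : ℕ) ^ 2 ≤ ∑ _j : Fin D, d ^ 2 :=
          Finset.sum_le_sum fun j _ => Nat.pow_le_pow_left (a j).2.le 2
      _ = D * d ^ 2 := by simp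
  have h1 := Finset.card_eq_sum_card_fiberwise hmaps
  have h2 : ∑ r ∈ Finset.range (D * d ^ 2 + 1), (D * d ^ 2 + 1) *
      (Finset.univ.filter fun a : Fin D → Fin d => ∑ j, (a j : ℕ) ^ 2 = r).card <
      ∑ _r ∈ Finset.range (D * d ^ 2 + 1), d ^ D := by
    refine Finset.sum_lt_sum_of_nonempty (by simp) fun r _ => ?_
    rw [← Fintype.card_subtype]
    exact h r
  rw [← Finset.mul_sum, ← h1] at h2
  simp at h2

theorem add_mul_lt_mul {k d i x a : ℕ} (hi : i < k) (hx : x < d) (ha : a < d) :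
    x + i * a < k * d := by
  have h1 : i * a ≤ (k - 1) * d := Nat.mul_le_mul (by omega) ha.le
  have h2 : (k - 1) * d + d = k * d := by
    rw [← Nat.succ_mul, Nat.succ_eq_add_one, Nat.sub_add_cancel (by omega)]
  omega

/-- The copy of the cycle `C_k` whose `i`-th vertex is `x + i a` in the `i`-th class. -/
def progressionCopy {k D d : ℕ} (x a : Fin D → Fin d) :
    (SimpleGraph.cycleGraph k).Copy (⊤ : SimpleGraph (Fin k × (Fin D → Fin (k * d)))) :=
  ⟨⟨fun i => (i, fun j => ⟨x j + i * a j, add_mul_lt_mul i.2 (x j).2 (a j).2⟩), fun h hij => h.ne (congrArg Prod.fst hij)⟩,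
    fun _ _ h => congrArg Prod.fst h⟩

theorem mem_copyEdges_progressionCopy {k D d : ℕ} {x a : Fin D → Fin d}
    {u v : Fin k × (Fin D → Fin (k * d))}
    (h : s(u, v) ∈ copyEdges (progressionCopy (k := k) x a)) :
    (SimpleGraph.cycleGraph k).Adj u.1 v.1 ∧
      (∀ j, (u.2 j : ℕ) = x j + u.1 * a j) ∧ ∀ j, (v.2 j : ℕ) = x j + v.1 * a j := by
  obtain ⟨p, q, hpq, rfl, rfl⟩ := mem_copyEdges_mk.1 h
  exact ⟨hpq, fun _ => rfl, fun _ => rfl⟩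

theorem pow_le_mul_exMulti_cycleGraph {k : ℕ} (hk3 : 3 ≤ k) (hk : Odd k) {D d n : ℕ}
    (hd : 1 ≤ d) (hn : k * (k * d) ^ D ≤ n) :
    d ^ D * d ^ D ≤ (D * d ^ 2 + 1) *
      exMulti (SimpleGraph.cycleGraph k) n (SimpleGraph.cycleGraph k) := by
  obtain ⟨r, hr⟩ := exists_large_sphere D d
  have : Nonempty (Fin k × (Fin D → Fin (k * d))) :=
    ⟨(⟨0, by omega⟩, fun _ => ⟨0, Nat.mul_pos (by omega) hd⟩)⟩
  have key := card_le_exMulti (G := SimpleGraph.cycleGraph k) (n := n) (cycleGraph_ne_bot hk3)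
    (ι := (Fin D → Fin d) × {a : Fin D → Fin d // ∑ j, (a j : ℕ) ^ 2 = r})
    (fun i => progressionCopy (k := k) i.1 i.2.1) ?_ (by simpa using hn) ?_
  · rw [Fintype.card_prod] at key
    calc d ^ D * d ^ D ≤ d ^ D * ((D * d ^ 2 + 1) *
          Fintype.card {a : Fin D → Fin d // ∑ j, (a j : ℕ) ^ 2 = r}) := Nat.mul_le_mul_left _ hr
      _ = (D * d ^ 2 + 1) * (d ^ D *
          Fintype.card {a : Fin D → Fin d // ∑ j, (a j : ℕ) ^ 2 = r}) := by ring
      _ ≤ _ := Nat.mul_le_mul_left _ (by simpa using key)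
  · rintro ⟨x, a, ha⟩ ⟨y, b, hb⟩ hne
    rw [Set.disjoint_left]
    intro e hi hj
    induction e with | _ u v =>
    obtain ⟨huv, hu, hv⟩ := mem_copyEdges_progressionCopy hi
    obtain ⟨-, hu', hv'⟩ := mem_copyEdges_progressionCopy hj
    have hval : (u.1 : ℤ) - v.1 ≠ 0 := fun h => huv.ne (Fin.ext (by omega))
    have hab : ∀ j, (a j : ℤ) = b j := by
      intro j
      have h1 : (x j : ℤ) + u.1 * a j = y j + u.1 * b j := by
        exact_mod_cast (hu j).symm.trans (hu' j)
      have h2 : (x j : ℤ) + v.1 * a j = y j + v.1 * b j := by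
        exact_mod_cast (hv j).symm.trans (hv' j)
      have h3 : ((u.1 : ℤ) - v.1) * ((a j : ℤ) - b j) = 0 := by linarith
      exact sub_eq_zero.1 ((mul_eq_zero.1 h3).resolve_left hval)
    have hab' : a = b := funext fun j => Fin.ext (by exact_mod_cast hab j)
    subst hab'
    refine hne ?_
    have hxy : x = y := funext fun j => Fin.ext (by
      have := (hu j).symm.trans (hu' j)
      dsimp only at this
      omega)
    subst hxy
    rfl
  · intro g col hcol hg
    have hedge : ∀ (a b : Fin k) (h : (SimpleGraph.cycleGraph k).Adj a b), _ := fun a b h =>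
      mem_copyEdges_progressionCopy (u := g a) (v := g b) (hg ⟨s(a, b), h⟩)
    -- Reparametrise the rainbow cycle so that its `i`-th vertex lies in layer `i`.
    obtain ⟨σ, hσ⟩ : ∃ σ : SimpleGraph.cycleGraph k →g SimpleGraph.cycleGraph k,
        ∀ i, (g (σ i)).1 = i := by
      obtain ⟨n, rfl⟩ : ∃ n, k = n + 2 := ⟨k - 2, by omega⟩
      exact exists_hom_rightInverse hk ⟨fun i => (g i).1, fun {a b} h => (hedge a b h).1⟩
    have hedge' : ∀ (p q : Fin k) (h : (SimpleGraph.cycleGraph k).Adj p q),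
        ∃ c, c = col ⟨s(σ p, σ q), σ.map_adj h⟩ ∧
        (∀ j, ((g (σ p)).2 j : ℤ) = c.1 j + p * c.2.1 j) ∧
        ∀ j, ((g (σ q)).2 j : ℤ) = c.1 j + q * c.2.1 j := by
      intro p q h
      obtain ⟨-, h1, h2⟩ := hedge _ _ (σ.map_adj h)
      refine ⟨_, rfl, fun j => ?_, fun j => ?_⟩
      · have := h1 j
        rw [hσ p] at this
        exact_mod_cast this
      · have := h2 j
        rw [hσ q] at this
        exact_mod_cast this
    have hstep : ∀ m, m < k - 1 → ∃ c : (Fin D → Fin d) ×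
        {a : Fin D → Fin d // ∑ j, (a j : ℕ) ^ 2 = r}, ∀ hm : m + 1 < k,
        c = col ⟨s(σ ⟨m, by omega⟩, σ ⟨m + 1, hm⟩), σ.map_adj (cycleGraph_adj_succ hm)⟩ ∧
        (∀ j, ((g (σ ⟨m, by omega⟩)).2 j : ℤ) = c.1 j + m * c.2.1 j) ∧
        ∀ j, ((g (σ ⟨m + 1, hm⟩)).2 j : ℤ) = c.1 j + (m + 1) * c.2.1 j := by
      intro m hm
      obtain ⟨c, hc, h1, h2⟩ := hedge' _ _ (cycleGraph_adj_succ (k := k) (i := m) (by omega))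
      exact ⟨c, fun _ => ⟨hc, h1, by exact_mod_cast h2⟩⟩
    obtain ⟨b, -, hb1, hb2⟩ := hedge' _ _ (cycleGraph_adj_last (k := k) (by omega))
    have : Nonempty ((Fin D → Fin d) × {a : Fin D → Fin d // ∑ j, (a j : ℕ) ^ 2 = r}) := ⟨b⟩
    choose! c hc using hstep
    have hsq : ∀ c : (Fin D → Fin d) × {a : Fin D → Fin d // ∑ j, (a j : ℕ) ^ 2 = r},
        ∑ j, ((c.2.1 j : ℕ) : ℤ) ^ 2 = r := fun c => by exact_mod_cast c.2.2
    have hsum : ∀ j, ∀ m (hm : m < k), ∑ i ∈ Finset.range m, ((c i).2.1 j : ℤ) =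
        (g (σ ⟨m, hm⟩)).2 j - (g (σ ⟨0, by omega⟩)).2 j := by
      intro j m
      induction m with
      | zero => intro _; simp
      | succ m ih =>
        intro hm
        obtain ⟨-, h1, h2⟩ := hc m (by omega) hm
        rw [Finset.sum_range_succ, ih (by omega), h1 j, h2 j]
        ring
    -- The path from layer `0` to layer `k - 1` is displaced by the sum of its directions; the
    -- closing edge, in the cycle `b`, makes this displacement `k - 1` times the direction of `b`.
    have hall := eq_of_sum_eq_mul_of_sum_sq_eq (t := k - 1) (r := r)
      (A := fun m j => ((c m).2.1 j : ℤ)) (B := fun j => (b.2.1 j : ℤ))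
      (fun m _ => hsq (c m)) (hsq b) (fun j => by
        rw [hsum j (k - 1) (by omega), hb1 j, hb2 j]
        simp)
    have hA : (c 0).2.1 = (c 1).2.1 := by
      funext j
      have := congrFun ((hall 0 (by omega)).trans (hall 1 (by omega)).symm) j
      exact Fin.ext (by exact_mod_cast this)
    obtain ⟨hc0, -, h01⟩ := hc 0 (by omega) (by omega)
    obtain ⟨hc1, h10, -⟩ := hc 1 (by omega) (by omega)
    have hX : (c 0).1 = (c 1).1 := by
      funext j
      have h1 := h01 j
      have h2 := h10 j
      simp only [Nat.cast_zero, zero_add, Nat.cast_one, one_mul] at h1 h2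
      rw [h1, hA] at h2
      exact Fin.ext (by exact_mod_cast add_right_cancel h2)
    -- The first two edges share layer `1` and a direction, hence a base point too: they have the
    -- same colour.
    have heq : c 0 = c 1 := Prod.ext hX (Subtype.ext hA)
    rw [hc0, hc1] at heq
    have hs := congrArg Subtype.val (hcol heq)
    have hinj := cycleGraph_hom_injective hk3 hk σ
    rw [Sym2.eq_iff] at hs
    rcases hs with ⟨h, -⟩ | ⟨h, -⟩
    · simpa using hinj h
    · simpa using hinj h

theorem isTwoSubLittleOOne_exMulti_cycleGraph {k : ℕ} (hk3 : 3 ≤ k) (hk : Odd k) :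
    IsTwoSubLittleOOne fun n =>
      exMulti (SimpleGraph.cycleGraph k) n (SimpleGraph.cycleGraph k) := by
  refine isTwoSubLittleOOne_of_le (exMulti_le_sq (cycleGraph_ne_bot hk3)) fun δ hδ => ?_
  -- In dimension `D + 1` the construction yields exponent `2D / (D + 1) = 2 - 2 / (D + 1)`, which
  -- must exceed `2 - δ`.
  obtain ⟨D', hD'⟩ := exists_nat_gt (2 / δ)
  obtain ⟨D, rfl⟩ : ∃ D, D' = D + 1 := by
    refine ⟨D' - 1, ?_⟩
    have : (0 : ℝ) < D' := lt_trans (by positivity) hD'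
    have : 0 < D' := by exact_mod_cast this
    omega
  have hD0 : (0 : ℝ) < (D + 1 : ℕ) := by positivity
  have hk0 : (0 : ℝ) < k := by exact_mod_cast (by omega : 0 < k)
  -- The real solution of `k * (k * z) ^ (D + 1) = n`, that is, the side length for which the layers
  -- fill `n` vertices.
  set z : ℕ → ℝ := fun n => ((n : ℝ) / (k : ℝ) ^ (D + 2)) ^ (1 / ((D + 1 : ℕ) : ℝ)) with hz
  have hzt : Tendsto z atTop atTop :=
    (tendsto_rpow_atTop (by positivity)).comp
      (tendsto_natCast_atTop_atTop.atTop_div_const (by positivity))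
  have hlt : 2 - δ < 2 * D / ((D + 1 : ℕ) : ℝ) := by
    rw [div_lt_iff₀ hδ] at hD'
    rw [lt_div_iff₀ hD0]
    push_cast at hD' ⊢
    nlinarith
  set C : ℝ := (1 / (k : ℝ) ^ (D + 2)) ^ (2 * D / ((D + 1 : ℕ) : ℝ)) / (2 ^ (2 * D) * (D + 2))
  filter_upwards [hzt.eventually_ge_atTop 1,
    eventually_rpow_le_mul_rpow (C := C) hlt (by positivity)] with n hn1 hnC
  set d := ⌊z n⌋₊
  have hd1 : 1 ≤ d := Nat.le_floor (by exact_mod_cast hn1)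
  have hdz : (d : ℝ) ≤ z n := Nat.floor_le (by linarith)
  have hzd : z n / 2 ≤ d := by
    have h1 := Nat.lt_floor_add_one (z n)
    have h2 : (1 : ℝ) ≤ d := by exact_mod_cast hd1
    change z n < d + 1 at h1
    linarith
  have hzpow : z n ^ (D + 1) = n / (k : ℝ) ^ (D + 2) := by
    rw [hz, ← Real.rpow_natCast, ← Real.rpow_mul (by positivity), one_div,
      inv_mul_cancel₀ hD0.ne', Real.rpow_one]
  have hcard : k * (k * d) ^ (D + 1) ≤ n := by
    have h1 : (k : ℝ) ^ (D + 2) * (d : ℝ) ^ (D + 1) ≤ n := by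
      calc (k : ℝ) ^ (D + 2) * (d : ℝ) ^ (D + 1) ≤ (k : ℝ) ^ (D + 2) * z n ^ (D + 1) := by gcongr
        _ = n := by rw [hzpow]; field_simp
    have h2 : k * (k * d) ^ (D + 1) = k ^ (D + 2) * d ^ (D + 1) := by ring
    rw [h2]
    exact_mod_cast h1
  have hmain := pow_le_mul_exMulti_cycleGraph hk3 hk hd1 hcard
  have hmain' : d ^ (2 * D) ≤ (D + 2) *
      exMulti (SimpleGraph.cycleGraph k) n (SimpleGraph.cycleGraph k) := by
    have h1 : (D + 1) * d ^ 2 + 1 ≤ (D + 2) * d ^ 2 := by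
      have : 1 ≤ d ^ 2 := Nat.one_le_pow _ _ hd1
      nlinarith
    have h2 := hmain.trans (Nat.mul_le_mul_right _ h1)
    rw [show d ^ (D + 1) * d ^ (D + 1) = d ^ 2 * d ^ (2 * D) by ring,
      show (D + 2) * d ^ 2 * exMulti (SimpleGraph.cycleGraph k) n (SimpleGraph.cycleGraph k) =
        d ^ 2 * ((D + 2) * exMulti (SimpleGraph.cycleGraph k) n (SimpleGraph.cycleGraph k))
        by ring] at h2
    exact Nat.le_of_mul_le_mul_left h2 (by positivity)
  have hzD : z n ^ (2 * D) = (1 / (k : ℝ) ^ (D + 2)) ^ (2 * D / ((D + 1 : ℕ) : ℝ)) *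
      (n : ℝ) ^ (2 * D / ((D + 1 : ℕ) : ℝ)) := by
    rw [← Real.mul_rpow (by positivity) (by positivity), hz, ← Real.rpow_natCast,
      ← Real.rpow_mul (by positivity)]
    congr 1
    · ring
    · push_cast
      ring
  refine hnC.trans ?_
  have h3 : (z n / 2) ^ (2 * D) ≤ (D + 2) *
      (exMulti (SimpleGraph.cycleGraph k) n (SimpleGraph.cycleGraph k) : ℝ) :=
    (pow_le_pow_left₀ (by linarith) hzd _).trans (by exact_mod_cast hmain')
  rw [div_pow, hzD, div_le_iff₀ (by positivity)] at h3
  have h4 : C * (n : ℝ) ^ (2 * D / ((D + 1 : ℕ) : ℝ)) =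
      (1 / (k : ℝ) ^ (D + 2)) ^ (2 * D / ((D + 1 : ℕ) : ℝ)) *
      (n : ℝ) ^ (2 * D / ((D + 1 : ℕ) : ℝ)) / (2 ^ (2 * D) * (D + 2)) := by
    simp only [C]
    ring
  rw [h4, div_le_iff₀ (by positivity)]
  linarith

end Behrend

/-! ### Counting homomorphisms in uniform pairs -/

section Counting

open Finset

/-- Exchanging `a` with the coordinate `y u` is an involution of the pairs `(y, a)`. -/
theorem sum_piFinset_sum_update {W X M : Type*} [Fintype W] [DecidableEq W] [AddCommMonoid M]
    (P : W → Finset X) (u : W) (f : (W → X) → M) :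
    ∑ y ∈ Fintype.piFinset P, ∑ a ∈ P u, f (Function.update y u a) =
      #(P u) • ∑ y ∈ Fintype.piFinset P, f y := by
  have h : ∑ p ∈ Fintype.piFinset P ×ˢ P u, f (Function.update p.1 u p.2) =
      ∑ p ∈ Fintype.piFinset P ×ˢ P u, f p.1 := by
    have hmem : ∀ p ∈ Fintype.piFinset P ×ˢ P u,
        (Function.update p.1 u p.2, p.1 u) ∈ Fintype.piFinset P ×ˢ P u := by
      rintro ⟨y, a⟩ h
      simp only [mem_product, Fintype.mem_piFinset] at h ⊢
      refine ⟨fun w => ?_, h.1 u⟩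
      by_cases hw : w = u
      · subst hw
        simpa using h.2
      · simpa [hw] using h.1 w
    refine sum_nbij' (fun p => (Function.update p.1 u p.2, p.1 u))
      (fun p => (Function.update p.1 u p.2, p.1 u)) hmem hmem ?_ ?_ ?_ <;> simp
  rw [sum_product] at h
  rw [h, sum_product, smul_sum]
  simp

variable {X : Type*} {H : SimpleGraph X}

/-- The lower bound on the edges between subsets of the two parts of a uniform pair. -/
theorem le_card_interedges_of_isUniform [DecidableRel H.Adj] {s t A B : Finset X} {η δ : ℝ} (hη : 0 ≤ η)
    (h : H.IsUniform η s t) (hδ : δ ≤ H.edgeDensity s t) (hA : A ⊆ s) (hB : B ⊆ t) :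
    δ * (#A * #B) - η * (#s * #t) ≤ #(H.interedges A B) := by
  have hAs : (#A : ℝ) ≤ #s := by exact_mod_cast card_le_card hA
  have hBt : (#B : ℝ) ≤ #t := by exact_mod_cast card_le_card hB
  have hδ1 : δ ≤ 1 := hδ.trans (by exact_mod_cast H.edgeDensity_le_one s t)
  have hAB : (0 : ℝ) ≤ #A * #B := by positivity
  have hst : (#A : ℝ) * #B ≤ #s * #t := by gcongr
  have h0 : (0 : ℝ) ≤ #(H.interedges A B) := by positivity
  -- If `A` or `B` is too small for uniformity, then `|A||B| ≤ η|s||t|`, and `δ ≤ 1` makes the left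
  -- side nonpositive.
  by_cases h1 : #s * η ≤ #A
  · by_cases h2 : #t * η ≤ #B
    · have h3 := (abs_lt.1 (h hA hB h1 h2)).1
      have h4 : (H.edgeDensity A B : ℝ) * (#A * #B) = #(H.interedges A B) := by
        rw [SimpleGraph.edgeDensity_def]
        push_cast
        rcases eq_or_ne ((#A : ℝ) * #B) 0 with h5 | h5
        · have : #(H.interedges A B) ≤ #A * #B := H.card_interedges_le_mul A B
          have : (#(H.interedges A B) : ℝ) ≤ #A * #B := by exact_mod_cast this
          rw [h5] at this ⊢
          linarith
        · rw [div_mul_cancel₀ _ h5]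
      rw [← h4]
      nlinarith
    · have : (#A : ℝ) * #B ≤ #s * (#t * η) := by
        push Not at h2
        gcongr
      nlinarith
  · have : (#A : ℝ) * #B ≤ #s * η * #t := by
      push Not at h1
      gcongr
    nlinarith

theorem sym2_map_update {W : Type*} [DecidableEq W] {e : Sym2 W} {u : W} (hu : u ∉ e) (y : W → X)
    (a : X) : e.map (Function.update y u a) = e.map y :=
  Sym2.map_congr fun _ hw => Function.update_of_ne (ne_of_mem_of_not_mem hw hu) _ _

/-- The maps which send every vertex into its prescribed set and every pair in `S` to an edge. -/
noncomputable def partiteHoms {W : Type*} [Fintype W] [DecidableEq W] (H : SimpleGraph X)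
    (P : W → Finset X) (S : Finset (Sym2 W)) : Finset (W → X) := by
  classical exact (Fintype.piFinset P).filter fun y => ∀ e ∈ S, e.map y ∈ H.edgeSet

theorem mem_partiteHoms {W : Type*} [Fintype W] [DecidableEq W] {P : W → Finset X}
    {S : Finset (Sym2 W)} {y : W → X} :
    y ∈ partiteHoms H P S ↔ (∀ w, y w ∈ P w) ∧ ∀ e ∈ S, e.map y ∈ H.edgeSet := by
  simp [partiteHoms]

/-- Freeze all coordinates but `u` and `v`. No pair in `S` contains both, so the admissible values
form a rectangle `A × B`, and the new constraint selects the edges between `A` and `B`. Uniformity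
bounds these from below; then average over the frozen coordinates. -/
theorem le_card_partiteHoms_insert [DecidableRel H.Adj] {W : Type*} [Fintype W] [DecidableEq W] [DecidableEq X]
    {P : W → Finset X} {S : Finset (Sym2 W)} {η δ : ℝ} {u v : W} (hη : 0 ≤ η)
    (hP : ∀ w, (P w).Nonempty) (huv : u ≠ v) (hS : s(u, v) ∉ S)
    (h : H.IsUniform η (P u) (P v)) (hδ : δ ≤ H.edgeDensity (P u) (P v)) :
    δ * #(partiteHoms H P S) - η * ∏ w, (#(P w) : ℝ) ≤
      #(partiteHoms H P (insert s(u, v) S)) := by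
  classical
  have havg : ∀ T ⊆ Fintype.piFinset P, ∑ y ∈ Fintype.piFinset P,
      (#((P u ×ˢ P v).filter fun p => Function.update (Function.update y u p.1) v p.2 ∈ T) : ℝ) =
      #(P u) * (#(P v) * #T) := by
    intro T hT
    have h1 := sum_piFinset_sum_update P v fun y => if y ∈ T then (1 : ℝ) else 0
    have h2 := sum_piFinset_sum_update P u fun y => ∑ b ∈ P v,
      if Function.update y v b ∈ T then (1 : ℝ) else 0
    rw [h1] at h2
    rw [sum_ite_mem, inter_eq_right.2 hT] at h2
    simp only [sum_const, nsmul_eq_mul, mul_one] at h2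
    rw [← h2]
    refine sum_congr rfl fun y _ => ?_
    rw [← sum_product', card_filter]
    push_cast
    rfl
  have hsub : ∀ S, partiteHoms H P S ⊆ Fintype.piFinset P := fun S y hy =>
    Fintype.mem_piFinset.2 (mem_partiteHoms.1 hy).1
  have hlocal : ∀ y ∈ Fintype.piFinset P,
      δ * (#((P u ×ˢ P v).filter fun p =>
        Function.update (Function.update y u p.1) v p.2 ∈ partiteHoms H P S) : ℝ) -
        η * (#(P u) * #(P v)) ≤
      (#((P u ×ˢ P v).filter fun p =>
        Function.update (Function.update y u p.1) v p.2 ∈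
          partiteHoms H P (insert s(u, v) S)) : ℝ) := by
    intro y hy
    rw [Fintype.mem_piFinset] at hy
    set A := (P u).filter fun a => ∀ e ∈ S, v ∉ e → e.map (Function.update y u a) ∈ H.edgeSet
      with hA
    set B := (P v).filter fun b => ∀ e ∈ S, u ∉ e → e.map (Function.update y v b) ∈ H.edgeSet
      with hB
    have hiff : ∀ a ∈ P u, ∀ b ∈ P v,
        (Function.update (Function.update y u a) v b ∈ partiteHoms H P S ↔ a ∈ A ∧ b ∈ B) := by
      intro a ha b hb
      have hmem : ∀ w, Function.update (Function.update y u a) v b w ∈ P w := by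
        intro w
        by_cases hw : w = v
        · subst hw; simpa using hb
        · by_cases hw' : w = u
          · subst hw'; simpa [hw] using ha
          · simpa [hw, hw'] using hy w
      rw [mem_partiteHoms, hA, hB, mem_filter, mem_filter]
      constructor
      · rintro ⟨-, h1⟩
        refine ⟨⟨ha, fun e he hve => ?_⟩, hb, fun e he hue => ?_⟩
        · rw [← sym2_map_update hve _ b]
          exact h1 e he
        · have := h1 e he
          rwa [Function.update_comm huv, sym2_map_update hue] at this
      · rintro ⟨⟨-, h1⟩, -, h2⟩
        refine ⟨hmem, fun e he => ?_⟩
        by_cases hve : v ∈ e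
        · by_cases hue : u ∈ e
          · exact absurd (((Sym2.mem_and_mem_iff huv).1 ⟨hue, hve⟩) ▸ he) hS
          · rw [Function.update_comm huv, sym2_map_update hue]
            exact h2 e he hue
        · rw [sym2_map_update hve]
          exact h1 e he hve
    have h1 : ((P u ×ˢ P v).filter fun p =>
        Function.update (Function.update y u p.1) v p.2 ∈ partiteHoms H P S) = A ×ˢ B := by
      ext ⟨a, b⟩
      rw [mem_filter, mem_product, mem_product]
      constructor
      · rintro ⟨⟨ha, hb⟩, hab⟩
        exact (hiff a ha b hb).1 hab
      · rintro ⟨ha, hb⟩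
        have ha' := filter_subset _ _ ha
        have hb' := filter_subset _ _ hb
        exact ⟨⟨ha', hb'⟩, (hiff a ha' b hb').2 ⟨ha, hb⟩⟩
    have h2 : ((P u ×ˢ P v).filter fun p =>
        Function.update (Function.update y u p.1) v p.2 ∈ partiteHoms H P (insert s(u, v) S)) =
        H.interedges A B := by
      ext ⟨a, b⟩
      have hins : ∀ z, z ∈ partiteHoms H P (insert s(u, v) S) ↔
          H.Adj (z u) (z v) ∧ z ∈ partiteHoms H P S := by
        intro z
        simp only [mem_partiteHoms, mem_insert, forall_eq_or_imp, Sym2.map_mk,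
          SimpleGraph.mem_edgeSet]
        tauto
      rw [mem_filter, hins, SimpleGraph.mem_interedges_iff, mem_product]
      simp only [Function.update_self, Function.update_of_ne huv]
      constructor
      · rintro ⟨⟨ha, hb⟩, hadj, hab⟩
        have := (hiff a ha b hb).1 hab
        exact ⟨this.1, this.2, hadj⟩
      · rintro ⟨ha, hb, hadj⟩
        have ha' := filter_subset _ _ ha
        have hb' := filter_subset _ _ hb
        exact ⟨⟨ha', hb'⟩, hadj, (hiff a ha' b hb').2 ⟨ha, hb⟩⟩
    rw [h1, h2, card_product]
    push_cast
    exact le_card_interedges_of_isUniform hη h hδ (filter_subset _ _) (filter_subset _ _)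
  have hsum := sum_le_sum hlocal
  rw [sum_sub_distrib, ← mul_sum, havg _ (hsub _), havg _ (hsub _), sum_const,
    Fintype.card_piFinset, nsmul_eq_mul] at hsum
  push_cast at hsum
  have hu : (0 : ℝ) < #(P u) := by exact_mod_cast (hP u).card_pos
  have hv : (0 : ℝ) < #(P v) := by exact_mod_cast (hP v).card_pos
  have hpos : (0 : ℝ) < #(P u) * #(P v) := mul_pos hu hv
  refine le_of_mul_le_mul_left ?_ hpos
  linarith

/-- A counting lemma for homomorphisms into a system of dense uniform pairs. -/
theorem le_card_partiteHoms [DecidableRel H.Adj] {W : Type*} [Fintype W] [DecidableEq W] [DecidableEq X]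
    {P : W → Finset X} {η δ : ℝ} (hη : 0 ≤ η) (hδ0 : 0 ≤ δ) (hδ1 : δ ≤ 1)
    (hP : ∀ w, (P w).Nonempty) (S : Finset (Sym2 W))
    (hS : ∀ u v, s(u, v) ∈ S → u ≠ v ∧ H.IsUniform η (P u) (P v) ∧
      δ ≤ H.edgeDensity (P u) (P v)) :
    (δ ^ #S - #S * η) * ∏ w, (#(P w) : ℝ) ≤ #(partiteHoms H P S) := by
  classical
  induction S using Finset.induction_on with
  | empty =>
    have : partiteHoms H P ∅ = Fintype.piFinset P := by
      ext y
      simp [mem_partiteHoms]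
    simp [this]
  | insert e S he ih =>
    induction e with | _ u v =>
    have ih := ih fun a b hab => hS a b (mem_insert_of_mem hab)
    obtain ⟨huv, hunif, hdens⟩ := hS u v (mem_insert_self _ _)
    have hstep := le_card_partiteHoms_insert hη hP huv he hunif hdens
    rw [card_insert_of_notMem he]
    have hprod : (0 : ℝ) ≤ ∏ w, (#(P w) : ℝ) := prod_nonneg fun _ _ => Nat.cast_nonneg _
    have h1 := mul_le_mul_of_nonneg_left ih hδ0
    refine le_trans ?_ ((sub_le_sub_right h1 _).trans hstep)
    push_cast
    have h2 : (#S : ℝ) * η * δ ≤ #S * η * 1 := by gcongr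
    have h3 := mul_le_mul_of_nonneg_right h2 hprod
    rw [pow_succ]
    linarith

/-- Few maps have their value at `r` in a small set determined by the other values. -/
theorem card_filter_mem_mul_le {W : Type*} [Fintype W] [DecidableEq W] [Fintype X] [DecidableEq X]
    (r : W) (T : (W → X) → Finset X) (hT : ∀ y a, T (Function.update y r a) = T y) {K : ℕ}
    (hK : ∀ y, #(T y) ≤ K) :
    #(univ.filter fun y : W → X => y r ∈ T y) * Fintype.card X ≤
      K * Fintype.card X ^ Fintype.card W := by
  have h := sum_piFinset_sum_update (fun _ : W => (univ : Finset X)) r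
    fun y => if y r ∈ T y then 1 else 0
  simp only [Function.update_self, hT, Fintype.piFinset_univ, smul_eq_mul, sum_boole,
    Nat.cast_id, card_univ] at h
  rw [mul_comm, ← h]
  calc ∑ y : W → X, #(univ.filter fun a => a ∈ T y) ≤ ∑ _y : W → X, K :=
        sum_le_sum fun y _ => by simpa using hK y
    _ = _ := by simp [mul_comm]

end Counting

/-! ### Cleaning by regularity -/

section Removal

open Finset SzemerediRegularity

variable {X : Type*} [Fintype X] [DecidableEq X] {H : SimpleGraph X} [DecidableRel H.Adj]
  {P : Finpartition (univ : Finset X)}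

/-- Lost ordered pairs lie in irregular pairs of parts (`4η ≤ ε / 2`), inside a part (`ε / 2`) or in
sparse pairs (`ε`). -/
theorem card_adj_and_not_regularityReduced_lt [Nonempty X] {ε η : ℝ} (hε : 0 < ε) (hη : 0 < η)
    (hηε : η ≤ ε / 8) (hP : P.IsEquipartition) (hPη : P.IsUniform H η)
    (hP' : 4 / ε ≤ #P.parts) :
    (#((univ ×ˢ univ).filter fun p : X × X =>
      H.Adj p.1 p.2 ∧ ¬ (H.regularityReduced P η (ε / 4)).Adj p.1 p.2) : ℝ) <
      2 * ε * (Fintype.card X : ℝ) ^ 2 := by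
  let A := (P.nonUniforms H η).biUnion fun (U, V) ↦ U ×ˢ V
  let B := P.parts.biUnion offDiag
  let C := (P.sparsePairs H (ε / 4)).biUnion fun (U, V) ↦ H.interedges U V
  have hsub : ((univ ×ˢ univ).filter fun p : X × X =>
      H.Adj p.1 p.2 ∧ ¬ (H.regularityReduced P η (ε / 4)).Adj p.1 p.2) ⊆ A ∪ B ∪ C := by
    rintro ⟨x, y⟩
    simp only [A, B, C, mem_filter, SimpleGraph.regularityReduced_adj, not_and, not_exists,
      not_le, mem_biUnion, mem_union, mem_product, Prod.exists, mem_offDiag, and_imp,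
      or_assoc, and_assoc, P.mk_mem_nonUniforms, Finpartition.mk_mem_sparsePairs,
      SimpleGraph.mem_interedges_iff]
    intro _ _ h h'
    replace h' := h' h
    obtain ⟨U, hU, hx⟩ := P.exists_mem (mem_univ x)
    obtain ⟨V, hV, hy⟩ := P.exists_mem (mem_univ y)
    obtain rfl | hUV := eq_or_ne U V
    · exact Or.inr (Or.inl ⟨U, hU, hx, hy, H.ne_of_adj h⟩)
    by_cases h₂ : H.IsUniform η U V
    · exact Or.inr <| Or.inr ⟨U, V, hU, hV, hUV, h' _ hU _ hV hx hy hUV h₂, hx, hy, h⟩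
    · exact Or.inl ⟨U, V, hU, hV, hUV, h₂, hx, hy⟩
  have hA : (#A : ℝ) < 4 * η * (#(univ : Finset X) : ℝ) ^ 2 :=
    hP.sum_nonUniforms_lt univ_nonempty hη hPη
  have hB : (#B : ℝ) ≤ ε / 2 * (#(univ : Finset X) : ℝ) ^ 2 := hP.card_biUnion_offDiag_le hε hP'
  have hC : (#C : ℝ) ≤ 4 * (ε / 4) * (#(univ : Finset X) : ℝ) ^ 2 :=
    hP.card_interedges_sparsePairs_le (G := H) (ε := ε / 4) (by positivity)
  have hcard := (card_le_card hsub).trans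
    ((card_union_le _ _).trans (Nat.add_le_add_right (card_union_le _ _) _))
  have hcard' : (#((univ ×ˢ univ).filter fun p : X × X =>
      H.Adj p.1 p.2 ∧ ¬ (H.regularityReduced P η (ε / 4)).Adj p.1 p.2) : ℝ) ≤
      #A + #B + #C := by exact_mod_cast hcard
  rw [card_univ] at hA hB hC
  have : η * (Fintype.card X : ℝ) ^ 2 ≤ ε / 8 * (Fintype.card X : ℝ) ^ 2 := by gcongr
  linarith

theorem le_card_of_mem_parts (hP : P.IsEquipartition) {M : ℕ} (hM : #P.parts ≤ M) {s : Finset X}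
    (hs : s ∈ P.parts) : (Fintype.card X : ℝ) / (2 * M) ≤ #s := by
  have hpos : 0 < #P.parts := card_pos.2 ⟨s, hs⟩
  have hle : #P.parts ≤ Fintype.card X := by simpa using P.card_parts_le_card
  have h1 : Fintype.card X / #P.parts ≤ #s := by simpa using hP.average_le_card_part hs
  have h2 := Nat.div_add_mod (Fintype.card X) #P.parts
  have h3 := Nat.mod_lt (Fintype.card X) hpos
  have h4 : 1 ≤ Fintype.card X / #P.parts := (Nat.one_le_div_iff hpos).2 hle
  have h5 : Fintype.card X ≤ 2 * #P.parts * #s := by nlinarith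
  have hM0 : (0 : ℝ) < M := by exact_mod_cast hpos.trans_le hM
  rw [div_le_iff₀ (by positivity)]
  have h6 : Fintype.card X ≤ #s * (2 * M) := h5.trans (by nlinarith)
  exact_mod_cast h6

end Removal

/-! ### Rainbow copies from many homomorphisms -/

section UpperBound

open Finset SzemerediRegularity

variable {V W : Type*} {F : SimpleGraph V} {G : SimpleGraph W}

/-- A dense set of homomorphisms of `G` into the union of the copies `c i` yields a rainbow copy
of `G`. -/
theorem hasRainbowCopy_of_card_lt [Fintype V] [Fintype W] [DecidableEq W] {n m : ℕ}
    (c : Fin m → F.Copy (⊤ : SimpleGraph (Fin n))) {Y : Finset (W → Fin n)}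
    (E : Finset (Sym2 W)) (hE : ∀ e, e ∈ E ↔ e ∈ G.edgeSet) (i₀ : Fin m)
    (hY : ∀ y ∈ Y, ∀ e ∈ E, ∃ i, e.map y ∈ copyEdges (c i))
    (hcard : Fintype.card W * ((Fintype.card W + #E * Fintype.card V) * n ^ Fintype.card W) <
      #Y * n) :
    HasRainbowCopy G c := by
  classical
  have hκ : ∃ κ : Sym2 (Fin n) → Fin m, ∀ e, (∃ i, e ∈ copyEdges (c i)) → e ∈ copyEdges (c (κ e)) :=
    ⟨fun e => if h : ∃ i, e ∈ copyEdges (c i) then h.choose else i₀, fun e h => by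
      simpa only [dif_pos h] using h.choose_spec⟩
  obtain ⟨κ, hκ⟩ := hκ
  -- Forbidden values for `y r`: the other values of `y`, and all vertices of the copies covering
  -- edges that avoid `r`. The set has bounded size and does not depend on `y r`.
  let T : W → (W → Fin n) → Finset (Fin n) := fun r y =>
    (univ.erase r).image y ∪
      (E.filter fun e => r ∉ e).biUnion fun e => univ.image fun v => c (κ (e.map y)) v
  have hTcard : ∀ r y, #(T r y) ≤ Fintype.card W + #E * Fintype.card V := by
    intro r y
    refine (card_union_le _ _).trans (Nat.add_le_add ?_ ?_)
    · exact card_image_le.trans (card_le_univ _)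
    · refine (card_biUnion_le_card_mul _ _ (Fintype.card V) fun e _ => ?_).trans
        (Nat.mul_le_mul_right _ (card_filter_le _ _))
      exact card_image_le.trans card_univ.le
  have hTupd : ∀ r y a, T r (Function.update y r a) = T r y := by
    intro r y a
    simp only [T]
    congr 1
    · refine image_congr fun w hw => ?_
      exact Function.update_of_ne (ne_of_mem_erase hw) _ _
    · refine biUnion_congr rfl fun e he => ?_
      rw [sym2_map_update (mem_filter.1 he).2]
  have hgood : ∃ y ∈ Y, ∀ r, y r ∉ T r y := by
    by_contra! h
    have hsub : Y ⊆ univ.biUnion fun r => univ.filter fun y : W → Fin n => y r ∈ T r y := by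
      intro y hy
      obtain ⟨r, hr⟩ := h y hy
      exact mem_biUnion.2 ⟨r, mem_univ _, mem_filter.2 ⟨mem_univ _, hr⟩⟩
    have h1 := Nat.mul_le_mul_right n ((card_le_card hsub).trans card_biUnion_le)
    rw [sum_mul] at h1
    have h2 : ∀ r ∈ (univ : Finset W), #(univ.filter fun y : W → Fin n => y r ∈ T r y) * n ≤
        (Fintype.card W + #E * Fintype.card V) * n ^ Fintype.card W := fun r _ => by
      simpa using card_filter_mem_mul_le r (T r) (hTupd r) (hTcard r)
    have h3 := h1.trans (sum_le_sum h2)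
    simp only [sum_const, card_univ, smul_eq_mul] at h3
    omega
  obtain ⟨y, hyY, hy⟩ := hgood
  have hinj : Function.Injective y := by
    intro q r hqr
    by_contra hne
    refine hy r (mem_union_left _ ?_)
    exact mem_image.2 ⟨q, mem_erase.2 ⟨hne, mem_univ _⟩, hqr⟩
  have hmem : ∀ e : G.edgeSet, (e : Sym2 W).map y ∈ copyEdges (c (κ ((e : Sym2 W).map y))) :=
    fun e => hκ _ (hY y hyY _ ((hE _).2 e.2))
  refine ⟨⟨⟨y, fun h => hinj.ne h.ne⟩, hinj⟩, fun e => κ ((e : Sym2 W).map y), ?_, hmem⟩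
  rintro ⟨e, he⟩ ⟨e', he'⟩ hee
  dsimp only at hee
  by_contra hne
  -- If distinct edges `e`, `e'` had one colour, an endpoint `r` of `e'` off `e` would land in the
  -- copy covering the image of `e`, a value forbidden by `T r y`.
  obtain ⟨r, hr', hr⟩ : ∃ r ∈ e', r ∉ e := by
    by_contra! h
    refine hne (Subtype.ext ?_)
    induction e' with | _ a b =>
    exact (Sym2.mem_and_mem_iff (SimpleGraph.Adj.ne he')).1
      ⟨h a (Sym2.mem_mk_left _ _), h b (Sym2.mem_mk_right _ _)⟩
  refine hy r (mem_union_right _ (mem_biUnion.2 ⟨e, mem_filter.2 ⟨(hE _).2 he, hr⟩, ?_⟩))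
  have h1 := hmem ⟨e', he'⟩
  dsimp only at h1
  rw [← hee] at h1
  have h2 : y r ∈ e'.map y := Sym2.mem_map.2 ⟨r, hr', rfl⟩
  obtain ⟨f, -, hf⟩ := h1
  rw [← hf, Sym2.mem_map] at h2
  obtain ⟨v, -, hv⟩ := h2
  exact mem_image.2 ⟨v, mem_univ _, hv⟩

theorem eventually_hasRainbowCopy [Fintype V] [Fintype W] (φ : G →g F) {ε : ℝ} (hε : 0 < ε) :
    ∀ᶠ n : ℕ in atTop, ∀ m (c : Fin m → F.Copy (⊤ : SimpleGraph (Fin n))),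
      EdgeDisjointCopies c → 2 * ε * (n : ℝ) ^ 2 ≤ m → HasRainbowCopy G c := by
  classical
  wlog hε1 : ε ≤ 1 generalizing ε
  · filter_upwards [this one_pos le_rfl] with n hn m c hc hm
    refine hn m c hc (le_trans ?_ hm)
    have : (1 : ℝ) ≤ ε := by linarith
    gcongr
  set E := G.edgeFinset with hE
  -- The first bound serves the cleaning step; the second keeps at least half of the main term `(ε /
  -- 4) ^ #E` in the counting lemma.
  set η : ℝ := min (ε / 8) ((ε / 4) ^ #E / (2 * (#E + 1))) with hη
  have hη0 : 0 < η := by positivity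
  set M := bound η ⌈4 / ε⌉₊ with hM
  have hM0 : (0 : ℝ) < M := by exact_mod_cast bound_pos η ⌈4 / ε⌉₊
  set κ : ℝ := (ε / 4) ^ #E / 2 * (1 / (2 * M)) ^ Fintype.card W with hκ
  have hκ0 : 0 < κ := by positivity
  set K : ℕ := Fintype.card W * (Fintype.card W + #E * Fintype.card V) with hK
  filter_upwards [eventually_ge_atTop ⌈4 / ε⌉₊, eventually_gt_atTop 0,
    tendsto_natCast_atTop_atTop.eventually_gt_atTop (K / κ)] with n hn hn0 hnK m c hc hm
  have hn0' : (0 : ℝ) < n := by exact_mod_cast hn0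
  have : Nonempty (Fin n) := ⟨⟨0, hn0⟩⟩
  let H : SimpleGraph (Fin n) :=
    { Adj := fun x y => ∃ i, s(x, y) ∈ copyEdges (c i)
      symm := ⟨fun x y ⟨i, hi⟩ => ⟨i, Sym2.eq_swap ▸ hi⟩⟩
      loopless := ⟨fun x ⟨i, hi⟩ => by
        obtain ⟨a, b, hab, ha, hb⟩ := mem_copyEdges_mk.1 hi
        exact hab.ne ((c i).injective (ha.trans hb.symm))⟩ }
  obtain ⟨P, hP₁, hP₂, hP₃, hP₄⟩ := szemeredi_regularity H hη0 (l := ⌈4 / ε⌉₊) (by simpa using hn)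
  have hbad := card_adj_and_not_regularityReduced_lt (H := H) hε hη0 (min_le_left _ _) hP₁ hP₄
    ((Nat.le_ceil _).trans (by exact_mod_cast hP₂))
  rw [Fintype.card_fin] at hbad
  -- Otherwise each copy loses an edge; by edge-disjointness these are `m ≥ 2εn²` distinct lost
  -- ordered pairs, too many.
  obtain ⟨i, hi⟩ : ∃ i, ∀ a b, F.Adj a b →
      (H.regularityReduced P η (ε / 4)).Adj (c i a) (c i b) := by
    by_contra! h
    choose a b hab hred using h
    have hle := card_le_card_of_injOn (s := (univ : Finset (Fin m)))
      (t := (univ ×ˢ univ).filter fun p : Fin n × Fin n =>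
        H.Adj p.1 p.2 ∧ ¬ (H.regularityReduced P η (ε / 4)).Adj p.1 p.2)
      (fun i => (c i (a i), c i (b i))) (fun i _ => by
        exact mem_filter.2 ⟨mem_product.2 ⟨mem_univ _, mem_univ _⟩,
          ⟨i, mem_copyEdges_mk.2 ⟨a i, b i, hab i, rfl, rfl⟩⟩, hred i⟩)
      (fun i _ j _ hij => by
        by_contra hne
        have hij := Prod.mk.inj hij
        refine Set.disjoint_left.1 (hc hne) (mem_copyEdges_mk.2 ⟨a i, b i, hab i, rfl, rfl⟩) ?_
        exact mem_copyEdges_mk.2 ⟨a j, b j, hab j, hij.1.symm, hij.2.symm⟩)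
    rw [card_univ, Fintype.card_fin] at hle
    have hle' := (Nat.cast_le (α := ℝ)).2 hle
    linarith
  -- Vertex `w` of `G` is assigned the part containing the vertex `φ w` of the surviving copy, so
  -- edges of `G` meet dense uniform pairs.
  have hcount := le_card_partiteHoms (H := H) (P := fun w => P.part (c i (φ w))) hη0.le
    (by positivity : 0 ≤ ε / 4) (by linarith)
    (fun w => ⟨c i (φ w), P.mem_part (mem_univ _)⟩) E (fun u v huv => by
      have huv : G.Adj u v := by simpa [hE] using huv
      obtain ⟨-, U, hU, U', hU', hu, hv, -, hunif, hdens⟩ := hi _ _ (φ.map_adj huv)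
      rw [P.part_eq_of_mem hU hu, P.part_eq_of_mem hU' hv]
      exact ⟨huv.ne, hunif, hdens⟩)
  have hprod : ((n : ℝ) / (2 * M)) ^ Fintype.card W ≤ ∏ w, (#(P.part (c i (φ w))) : ℝ) := by
    rw [← card_univ, ← prod_const]
    refine prod_le_prod (fun _ _ => by positivity) fun w _ => ?_
    simpa using le_card_of_mem_parts hP₁ hP₃ (P.part_mem.2 (mem_univ (c i (φ w))))
  have hcoef : (ε / 4) ^ #E / 2 ≤ (ε / 4) ^ #E - #E * η := by
    have h1 : η ≤ (ε / 4) ^ #E / (2 * (#E + 1)) := min_le_right _ _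
    rw [le_div_iff₀ (by positivity)] at h1
    nlinarith
  have hlow : κ * (n : ℝ) ^ Fintype.card W ≤
      #(partiteHoms H (fun w => P.part (c i (φ w))) E) := by
    refine le_trans ?_ hcount
    calc κ * (n : ℝ) ^ Fintype.card W
        = (ε / 4) ^ #E / 2 * ((n : ℝ) / (2 * M)) ^ Fintype.card W := by
          rw [hκ, mul_assoc, ← mul_pow]
          congr 2
          ring
      _ ≤ _ := mul_le_mul hcoef hprod (by positivity)
          (le_trans (by positivity : 0 ≤ (ε / 4) ^ #E / 2) hcoef)
  refine hasRainbowCopy_of_card_lt c E (by simp [hE]) i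
    (Y := partiteHoms H (fun w => P.part (c i (φ w))) E) (fun y hy e he => ?_) ?_
  · have := (mem_partiteHoms.1 hy).2 e he
    generalize e.map y = e' at this
    induction e' with | _ x z => exact this
  · have h1 : (K : ℝ) * (n : ℝ) ^ Fintype.card W <
        #(partiteHoms H (fun w => P.part (c i (φ w))) E) * n := by
      rw [div_lt_iff₀ hκ0] at hnK
      calc (K : ℝ) * (n : ℝ) ^ Fintype.card W < n * κ * (n : ℝ) ^ Fintype.card W := by gcongr
        _ = κ * (n : ℝ) ^ Fintype.card W * n := by ring
        _ ≤ _ := by gcongr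
    rw [← mul_assoc]
    exact_mod_cast h1

theorem isSubquadratic_exMulti_of_hom [Fintype V] [Fintype W] (φ : G →g F) :
    IsSubquadratic fun n => exMulti F n G := by
  refine isLittleO_iff.2 fun ε hε => ?_
  filter_upwards [eventually_hasRainbowCopy φ (half_pos hε)] with n hn
  rw [Real.norm_natCast, norm_pow, Real.norm_natCast]
  have h : exMulti F n G ≤ ⌊ε * (n : ℝ) ^ 2⌋₊ := by
    refine exMulti_le fun m c hc hG => Nat.le_floor ?_
    by_contra! h
    exact hG (hn m c hc (by linarith))
  exact (Nat.cast_le.2 h).trans (Nat.floor_le (by positivity))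

end UpperBound

/-! ### Consequences for graphs with a given odd girth -/

theorem IsOddGirth.odd {V : Type*} {G : SimpleGraph V} {k : ℕ} (h : IsOddGirth G k) : Odd k :=
  h.1.1

theorem IsOddGirth.three_le {V : Type*} {G : SimpleGraph V} {k : ℕ} (h : IsOddGirth G k) :
    3 ≤ k := by
  obtain ⟨-, v, p, hp, rfl⟩ := h.1
  exact hp.three_le_length

theorem IsOddGirth.cycleGraph_isContained {V : Type*} {G : SimpleGraph V} {k : ℕ}
    (h : IsOddGirth G k) : (SimpleGraph.cycleGraph k).IsContained G :=
  (SimpleGraph.cycleGraph_isContained_iff h.three_le).2 h.1.2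

theorem IsOddGirth.ne_bot {V : Type*} {G : SimpleGraph V} {k : ℕ} (h : IsOddGirth G k) :
    G ≠ ⊥ := by
  rintro rfl
  obtain ⟨f⟩ := h.cycleGraph_isContained
  exact f.toHom.map_adj (cycleGraph_adj_succ (i := 0) (by have := h.three_le; omega))

theorem isTwoSubLittleOOne_exMulti_cycleGraph_of_isOddGirth {W : Type*} {G : SimpleGraph W} {k : ℕ}
    (hG : IsOddGirth G k) :
    IsTwoSubLittleOOne fun n => exMulti (SimpleGraph.cycleGraph k) n G := by
  obtain ⟨f⟩ := hG.cycleGraph_isContained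
  have hne := cycleGraph_ne_bot hG.three_le
  exact (isTwoSubLittleOOne_exMulti_cycleGraph hG.three_le hG.odd).mono
    (exMulti_le_sq hne) (exMulti_mono_right hne f)

theorem isTwoSubLittleOOne_exMulti_of_hom_cycleGraph {V W : Type*} [Fintype V] {F : SimpleGraph V}
    {G : SimpleGraph W} {k : ℕ} (hF : F ≠ ⊥) (hG : IsOddGirth G k)
    (φ : F →g SimpleGraph.cycleGraph k) : IsTwoSubLittleOOne fun n => exMulti F n G := by
  obtain ⟨f⟩ := hG.cycleGraph_isContained
  obtain ⟨a, -⟩ := exists_adj_of_ne_bot hF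
  have hs : 1 ≤ Fintype.card V := Fintype.card_pos_iff.2 ⟨a⟩
  have h := isTwoSubLittleOOne_blowUp (cycleGraph_ne_bot hG.three_le)
    (cycleGraph_hom_injective hG.three_le hG.odd)
    (isTwoSubLittleOOne_exMulti_cycleGraph hG.three_le hG.odd) hs
  exact h.mono (exMulti_le_sq hF) fun n =>
    (exMulti_mono_left hF (copyBlowUpOfHom φ) n).trans (exMulti_mono_right hF f n)

end MulticolorTuran

theorem mainTheorem4 {V W : Type*} [Fintype V] [Fintype W]
    (F : SimpleGraph V) (G : SimpleGraph W) :
    -- (1) passing to blow-ups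
    (F ≠ ⊥ →
      MulticolorTuran.IsTwoSubLittleOOne (fun n => MulticolorTuran.exMulti F n G) →
      (∀ m : ℕ, m < Fintype.card W → ∀ G' : SimpleGraph (Fin m),
        MulticolorTuran.IsEpimorphicImage G G' → ¬ G'.IsContained F) →
      ∀ s : ℕ, 1 ≤ s →
        MulticolorTuran.IsTwoSubLittleOOne
          (fun n => MulticolorTuran.exMulti (MulticolorTuran.blowUp F s) n G) ∧
        (MulticolorTuran.IsSubquadratic (fun n => MulticolorTuran.exMulti F n G) →
          MulticolorTuran.IsSubquadratic
            (fun n => MulticolorTuran.exMulti (MulticolorTuran.blowUp F s) n G))) ∧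
    -- (2) graphs with the same odd girth
    (∀ k : ℕ, MulticolorTuran.IsOddGirth F k → MulticolorTuran.IsOddGirth G k →
      F.chromaticNumber = 3 → Nonempty (G →g F) →
        MulticolorTuran.IsTwoSubLittleOOne
          (fun n => MulticolorTuran.exMulti (SimpleGraph.cycleGraph k) n G) ∧
        MulticolorTuran.IsSubquadratic (fun n => MulticolorTuran.exMulti F n G) ∧
        (Nonempty (F →g SimpleGraph.cycleGraph k) →
          MulticolorTuran.IsTwoSubLittleOOne (fun n => MulticolorTuran.exMulti F n G))) ∧
    -- the special case of two odd cycles of the same length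
    (∀ k : ℕ, 3 ≤ k → Odd k →
      MulticolorTuran.IsTwoSubLittleOOne
        (fun n => MulticolorTuran.exMulti (SimpleGraph.cycleGraph k) n
          (SimpleGraph.cycleGraph k)) ∧
      MulticolorTuran.IsSubquadratic
        (fun n => MulticolorTuran.exMulti (SimpleGraph.cycleGraph k) n
          (SimpleGraph.cycleGraph k))) := by
  refine ⟨fun hF h hepi s hs => ⟨?_, fun hsub => ?_⟩, fun k hFk hGk _ hhom => ⟨?_, ?_, ?_⟩,
    fun k hk3 hk => ⟨?_, ?_⟩⟩
  · exact MulticolorTuran.isTwoSubLittleOOne_blowUp hF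
      (MulticolorTuran.injective_of_forall_isEpimorphicImage hepi) h hs
  · exact hsub.mono (MulticolorTuran.exMulti_mono_left hF (MulticolorTuran.copyBlowUp F hs))
  · exact MulticolorTuran.isTwoSubLittleOOne_exMulti_cycleGraph_of_isOddGirth hGk
  · exact MulticolorTuran.isSubquadratic_exMulti_of_hom hhom.some
  · rintro ⟨φ⟩
    exact MulticolorTuran.isTwoSubLittleOOne_exMulti_of_hom_cycleGraph hFk.ne_bot hGk φ
  · exact MulticolorTuran.isTwoSubLittleOOne_exMulti_cycleGraph hk3 hk
  · exact MulticolorTuran.isSubquadratic_exMulti_of_hom SimpleGraph.Hom.id
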